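/- **Definitions.** For a partition $\lambda$ with $\ell(\lambda)$ parts (and $\lambda_i=0$ for $i>\ell(\lambda)$) let $\lambda'$ be its conjugate. A skew shape $\lambda/\mu$ (with $\mu\subseteq\lambda$) is the set of cells of the Young diagram of $\lambda$ that are not in that of $\mu$; its size is its number of cells. A *ribbon* is a connected skew shape (any two cells are joined by a chain of cells of the shape in which consecutive cells share an edge) that contains no $2\times 2$ block of cells. For an integer $m\ge 0$ let $\mathcal R_m$ be the set of ribbons $R=\lambda/\mu$ of size $m$ normalized up to translation: each of the $\ell(\lambda)$ rows and each of the $\lambda_1$ columns of $\lambda$ contains a cell of $\lambda/\mu$. (For $m=0$ the empty shape counts as a ribbon, so $\mathcal R_0=\{\emptyset/\emptyset\}$.) For an infinite sequence of variables $\vec x=(x_1,x_2,\dots)$ let $e_d(\vec x)=\sum_{i_1<\dots<i_d}x_{i_1}\cdots x_{i_d}$ for $d>0$, $e_0=1$, $e_d=0$ for $d<0$. For $R=\lambda/\mu$ put $$\mathrm{JT}_{R}(\vec x)=\bigl(e_{\lambda_i-\mu_j-i+j}(\vec x)\bigr)_{i,j=1}^{\ell(\lambda)},$$ let $s_\lambda(\vec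 x)=\det\bigl(e_{\lambda'_i-i+j}(\vec x)\bigr)_{i,j=1}^{\lambda_1}$ be the Schur function, let $f^\lambda$ be the number of standard Young tableaux of shape $\lambda$, and let $*$ be the Hadamard (entrywise) product of matrices. Determinants are taken in the ring of formal power series over $\mathbb Q$ in all the variables of the alphabets that occur. **Proposition.** Let $k\ge 1$ and $m\ge 0$ be integers and let $\vec x^{(1)},\dots,\vec x^{(k)}$ be $k$ disjoint infinite sequences of variables. The set $\mathcal R_m$ is finite and $$\sum_{R\in\mathcal R_m}\det\left(\mathrm{JT}_R(\vec x^{(1)})*\cdots*\mathrm{JT}_R(\vec x^{(k)})\right)=\prod_{i=1}^k\Bigl(\sum_{\lambda\vdash m}f^\lambda s_\lambda(\vec x^{(i)})\Bigr).$$ Moreover, the coefficient of $\prod_{i=1}^k x^{(i)}_1x^{(i)}_2\cdots x^{(i)}_m$ on either side is $(m!)^k$. -/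

import Mathlib

noncomputable section

namespace HadamardJT

/-! ### Skew shapes and ribbons

Young diagrams are Mathlib's `YoungDiagram`; rows and columns are numbered from `0`, so
`mu.rowLen i` is the part of index `i + 1`, and `mu.colLen 0` is the number of parts. -/

/-- A skew shape `outer / inner`. -/
@[ext]
structure SkewShape where
  outer : YoungDiagram
  inner : YoungDiagram
  le : inner ≤ outer

namespace SkewShape

/-- The cells of a skew shape: the set-theoretic difference of the two diagrams. -/
def cells (R : SkewShape) : Finset (ℕ × ℕ) := R.outer.cells \ R.inner.cells

/-- The number of cells. -/
def size (R : SkewShape) : ℕ := R.cells.card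

/-- Two cells share an edge. -/
def Adjacent (c d : ℕ × ℕ) : Prop :=
  (c.1 = d.1 ∧ (c.2 + 1 = d.2 ∨ d.2 + 1 = c.2)) ∨
  (c.2 = d.2 ∧ (c.1 + 1 = d.1 ∨ d.1 + 1 = c.1))

/-- Any two cells are joined by a chain of adjacent cells of the shape. -/
def Connected (R : SkewShape) : Prop :=
  ∀ c ∈ R.cells, ∀ d ∈ R.cells,
    Relation.ReflTransGen (fun a b => a ∈ R.cells ∧ b ∈ R.cells ∧ Adjacent a b) c d

/-- The shape contains a `2 × 2` block of cells. -/
def HasTwoByTwoBlock (R : SkewShape) : Prop :=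
  ∃ i j : ℕ, (i, j) ∈ R.cells ∧ (i, j + 1) ∈ R.cells ∧
    (i + 1, j) ∈ R.cells ∧ (i + 1, j + 1) ∈ R.cells

/-- A ribbon: a connected skew shape without a `2 × 2` block. -/
def IsRibbon (R : SkewShape) : Prop := R.Connected ∧ ¬ R.HasTwoByTwoBlock

/-- The shape meets each of the rows and each of the columns of its outer diagram. This selects one
representative of every connected shape up to vertical and horizontal translation. -/
def IsNormalized (R : SkewShape) : Prop :=
  {i : ℕ | R.inner.rowLen i < R.outer.rowLen i} = Set.Iio (R.outer.colLen 0) ∧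
  {j : ℕ | R.inner.colLen j < R.outer.colLen j} = Set.Iio (R.outer.rowLen 0)

end SkewShape

theorem finite_setOf_cells_subset (S : Finset (ℕ × ℕ)) :
    {mu : YoungDiagram | mu.cells ⊆ S}.Finite := by
  refine Set.Finite.of_finite_image (f := YoungDiagram.cells)
    (S.powerset.finite_toSet.subset ?_) ?_
  · rintro _ ⟨mu, hmu, rfl⟩
    simpa using hmu
  · intro a _ b _ h
    exact YoungDiagram.ext h

theorem finite_setOf_card_eq (m : ℕ) : {mu : YoungDiagram | mu.card = m}.Finite := by
  refine (finite_setOf_cells_subset (Finset.range m ×ˢ Finset.range m)).subset ?_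
  rintro mu rfl ⟨i, j⟩ hc
  rw [YoungDiagram.mem_cells] at hc
  simp only [Finset.mem_product, Finset.mem_range]
  constructor
  · refine (YoungDiagram.mem_iff_lt_colLen.1 hc).trans_le ?_
    rw [YoungDiagram.colLen_eq_card]
    exact Finset.card_le_card (Finset.filter_subset _ _)
  · refine (YoungDiagram.mem_iff_lt_rowLen.1 hc).trans_le ?_
    rw [YoungDiagram.rowLen_eq_card]
    exact Finset.card_le_card (Finset.filter_subset _ _)

/-- The partitions of `m`, as Young diagrams. -/
def partitionsOf (m : ℕ) : Finset YoungDiagram := (finite_setOf_card_eq m).toFinset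

theorem finite_setOf_normalized (m : ℕ) :
    {R : SkewShape | R.IsNormalized ∧ R.size = m}.Finite := by
  have hB := finite_setOf_cells_subset (Finset.range m ×ˢ Finset.range m)
  refine Set.Finite.of_finite_image (f := fun R : SkewShape => (R.outer, R.inner))
    ((hB.prod hB).subset ?_) ?_
  · rintro _ ⟨R, ⟨⟨h1, h2⟩, rfl⟩, rfl⟩
    have hr : R.outer.colLen 0 ≤ R.size := by
      have := Finset.card_le_card_of_injOn (s := Finset.range (R.outer.colLen 0)) (t := R.cells)
        (fun i => (i, R.inner.rowLen i)) (by
          intro i hi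
          have hi' : i ∈ Set.Iio (R.outer.colLen 0) := by simpa using hi
          rw [← h1] at hi'
          simpa [SkewShape.cells, YoungDiagram.mem_iff_lt_rowLen] using hi')
        (by intro a _ b _ h; exact congrArg Prod.fst h)
      simpa [SkewShape.size] using this
    have hc : R.outer.rowLen 0 ≤ R.size := by
      have := Finset.card_le_card_of_injOn (s := Finset.range (R.outer.rowLen 0)) (t := R.cells)
        (fun j => (R.inner.colLen j, j)) (by
          intro j hj
          have hj' : j ∈ Set.Iio (R.outer.rowLen 0) := by simpa using hj
          rw [← h2] at hj'
          simpa [SkewShape.cells, YoungDiagram.mem_iff_lt_colLen] using hj')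
        (by intro a _ b _ h; exact congrArg Prod.snd h)
      simpa [SkewShape.size] using this
    have ho : R.outer.cells ⊆ Finset.range R.size ×ˢ Finset.range R.size := by
      rintro ⟨i, j⟩ hij
      rw [YoungDiagram.mem_cells] at hij
      simp only [Finset.mem_product, Finset.mem_range]
      exact ⟨((YoungDiagram.mem_iff_lt_colLen.1 hij).trans_le
          (R.outer.colLen_anti 0 j (Nat.zero_le _))).trans_le hr,
        ((YoungDiagram.mem_iff_lt_rowLen.1 hij).trans_le
          (R.outer.rowLen_anti 0 i (Nat.zero_le _))).trans_le hc⟩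
    exact ⟨ho, (YoungDiagram.cells_subset_iff.2 R.le).trans ho⟩
  · intro a _ b _ h
    exact SkewShape.ext (congrArg Prod.fst h) (congrArg Prod.snd h)

theorem finite_setOf_ribbon (m : ℕ) :
    {R : SkewShape | R.IsRibbon ∧ R.IsNormalized ∧ R.size = m}.Finite :=
  (finite_setOf_normalized m).subset fun _ h => h.2

/-- The ribbons of size `m`, up to translation. -/
def ribbons (m : ℕ) : Finset SkewShape := (finite_setOf_ribbon m).toFinset

/-! ### Standard Young tableaux -/

/-- A tableau is standard if each of `1, …, |mu|` appears exactly once. -/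
def IsStandard {mu : YoungDiagram} (T : SemistandardYoungTableau mu) : Prop :=
  Set.BijOn (fun c : ℕ × ℕ => T c.1 c.2) (mu.cells : Set (ℕ × ℕ)) (Set.Icc 1 mu.card)

/-- The number of standard Young tableaux of shape `mu`. -/
def numSYT (mu : YoungDiagram) : ℕ :=
  Nat.card {T : SemistandardYoungTableau mu // IsStandard T}

/-! ### Symmetric functions

Symmetric functions live in the ring of formal power series over `ℚ` in variables indexed by `ℕ`;
the variable of index `j` plays the role of `x_{j+1}`. -/

open Classical in
/-- The elementary symmetric function `e_d`, the sum of all squarefree monomials of degree `d`.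
It is `1` for `d = 0` and `0` for `d < 0`. -/
def elemSymm (d : ℤ) : MvPowerSeries ℕ ℚ :=
  fun a => if (∀ j, a j ≤ 1) ∧ (a.degree : ℤ) = d then 1 else 0

/-- The (dual) Jacobi--Trudi matrix `(e_{λ_i - μ_j - i + j})`, with one row for each part of the
outer partition. -/
def jacobiTrudi (R : SkewShape) :
    Matrix (Fin (R.outer.colLen 0)) (Fin (R.outer.colLen 0)) (MvPowerSeries ℕ ℚ) :=
  Matrix.of fun i j =>
    elemSymm ((R.outer.rowLen i : ℤ) - (R.inner.rowLen j : ℤ) - (i : ℤ) + (j : ℤ))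

/-- The Schur function `s_λ = det (e_{λ'_i - i + j})`, where `λ'` is the conjugate partition. -/
def schur (mu : YoungDiagram) : MvPowerSeries ℕ ℚ :=
  (jacobiTrudi ⟨mu.transpose, ⊥, bot_le⟩).det

/-! ### Several alphabets -/

instance tendstoCofinite_prodMk {k : ℕ} (i : Fin k) :
    Filter.TendstoCofinite (fun j : ℕ => (i, j)) :=
  Filter.tendstoCofinite_of_injective (Prod.mk_right_injective i)

/-- Write a power series in the alphabet of index `i`: `f ↦ f(x^(i))`. The variable of index
`(i, j)` plays the role of `x^(i)_{j+1}`. -/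
def inAlphabet {k : ℕ} (i : Fin k) :
    MvPowerSeries ℕ ℚ →ₐ[ℚ] MvPowerSeries (Fin k × ℕ) ℚ :=
  MvPowerSeries.rename (fun j : ℕ => (i, j))

/-- The Hadamard (entrywise) product `A(x^(1)) * ⋯ * A(x^(k))` of the copies of one matrix
in the `k` alphabets. -/
def hadamardPower (k : ℕ) {n : ℕ} (A : Matrix (Fin n) (Fin n) (MvPowerSeries ℕ ℚ)) :
    Matrix (Fin n) (Fin n) (MvPowerSeries (Fin k × ℕ) ℚ) :=
  Matrix.of fun a b => ∏ i : Fin k, inAlphabet i (A a b)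

/-- The exponent of the monomial `∏_i x^(i)_1 ⋯ x^(i)_m`. -/
def allOnes (k m : ℕ) : Fin k × ℕ →₀ ℕ :=
  ∑ i : Fin k, ∑ j ∈ Finset.range m, Finsupp.single (i, j) 1

end HadamardJT

end

open HadamardJT

/-! Both sides equal `∏ i, e_1(x^(i)) ^ m`.

Ribbons. A Hadamard product of Jacobi–Trudi matrices is again of the form `g (λ_i - μ_j - i + j)`,
now with `g d = ∏ i, e_d(x^(i))`. All that matters about `g` is that `g 0 = 1` and that `g` vanishes
at negative integers. Normalized ribbons are exactly the rims of Young diagrams (`eq_rimShape`), and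
a ribbon with at least two cells arises from a unique smaller one by adding a cell above or to the
right of its top right end (`sum_diagramsOfRim_succ`). Expanding the determinant of the taller
extension along its first column gives `g 1` times the old determinant minus the determinant of the
wider extension (`jtDet_add_jtDet`). So the two extensions together contribute `g 1` times the old
determinant, and the total over size `m` is `g 1 ^ m` (`sum_skewDet_ribbons`).

Schur functions. `∑ f^λ s_λ = e_1 ^ m` follows by induction from the one-cell Pieri rule
(`elemSymm_one_mul_schur`) and the branching rule for standard tableaux (`numSYT_eq_sum`). The Pieri
rule is a determinant identity: incrementing the rows one at a time has the same total as shifting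
the columns one at a time, and all but the last column shift produce a repeated column
(`mul_jtDet_eq_sum`).

The coefficient is then read off from powers of `e_1`, one alphabet at a time. -/

noncomputable section

namespace HadamardJT

/-! ### Jacobi--Trudi type determinants -/

section Determinants

variable {A : Type*} [CommRing A]

/-- The determinant of the matrix `(g (a_i - b_j - i + j))` of size `n`. -/
def jtDet (g : ℤ → A) (n : ℕ) (a b : ℕ → ℤ) : A :=
  (Matrix.of fun i j : Fin n => g (a i - b j - (i : ℕ) + (j : ℕ))).det

theorem jtDet_congr (g : ℤ → A) {n : ℕ} {a a' b b' : ℕ → ℤ} (ha : ∀ i < n, a i = a' i)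
    (hb : ∀ i < n, b i = b' i) : jtDet g n a b = jtDet g n a' b' := by
  unfold jtDet
  congr 1
  ext i j
  simp [ha i i.2, hb j j.2]

/-- The cofactors along row `i` do not involve row `i`, so those of `M` still serve after the
replacement. -/
theorem det_updateRow_eq_sum {ι : Type*} [Fintype ι] [DecidableEq ι] (M : Matrix ι ι A) (i : ι)
    (v : ι → A) : (M.updateRow i v).det = ∑ j, v j * M.adjugate j i := by
  rw [← Matrix.cramer_transpose_apply, Matrix.cramer_eq_adjugate_mulVec,
    ← Matrix.adjugate_transpose]
  simp [Matrix.mulVec, dotProduct, mul_comm]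

theorem det_updateCol_eq_sum {ι : Type*} [Fintype ι] [DecidableEq ι] (M : Matrix ι ι A) (j : ι)
    (v : ι → A) : (M.updateCol j v).det = ∑ i, v i * M.adjugate j i := by
  rw [← Matrix.cramer_apply, Matrix.cramer_eq_adjugate_mulVec]
  simp [Matrix.mulVec, dotProduct, mul_comm]

/-- Replacing the rows of `M` by those of `N` one at a time has the same total determinant as
replacing the columns one at a time. -/
theorem sum_det_updateRow_eq_sum_det_updateCol {ι : Type*} [Fintype ι] [DecidableEq ι]
    (M N : Matrix ι ι A) :
    ∑ i, (M.updateRow i (N i)).det = ∑ j, (M.updateCol j fun i => N i j).det := by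
  -- Both sides are the trace of `N * M.adjugate`.
  simp only [det_updateRow_eq_sum, det_updateCol_eq_sum]
  exact Finset.sum_comm

theorem det_eq_mul_of_last_row {n : ℕ} (M : Matrix (Fin (n + 1)) (Fin (n + 1)) A)
    (h : ∀ j : Fin n, M (Fin.last n) j.castSucc = 0) :
    M.det = M (Fin.last n) (Fin.last n) * (M.submatrix Fin.castSucc Fin.castSucc).det := by
  rw [Matrix.det_succ_row M (Fin.last n), Fin.sum_univ_castSucc]
  simp [h, ← two_mul, pow_mul]

/-- A zero part at the end contributes the last row `(0, …, 0, 1)`, so padding a partition by zeros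
is harmless. -/
theorem jtDet_succ_of_eq_zero {g : ℤ → A} (g0 : g 0 = 1) (hg : ∀ d < 0, g d = 0) {n : ℕ}
    {a : ℕ → ℤ} (ha : a n = 0) : jtDet g (n + 1) a 0 = jtDet g n a 0 := by
  unfold jtDet
  rw [det_eq_mul_of_last_row]
  · simp only [Matrix.of_apply, Fin.val_last, ha]
    simp only [Pi.zero_apply, sub_zero, zero_sub, neg_add_cancel, g0, one_mul]
    rfl
  · intro j
    simp only [Matrix.of_apply, Fin.val_last, ha]
    apply hg
    simp

/-- Adding one to a single entry of the index sequence, in all possible ways, multiplies the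
determinant by `g 1`. -/
theorem mul_jtDet_eq_sum {g : ℤ → A} (hg : ∀ d < 0, g d = 0) {n : ℕ}
    {a : ℕ → ℤ} (ha : a n = 0) :
    g 1 * jtDet g n a 0 =
      ∑ i : Fin (n + 1), jtDet g (n + 1) (Function.update a i (a i + 1)) 0 := by
  set M : Matrix (Fin (n + 1)) (Fin (n + 1)) A :=
    Matrix.of fun i j => g (a i - (i : ℕ) + (j : ℕ)) with hM
  set N : Matrix (Fin (n + 1)) (Fin (n + 1)) A :=
    Matrix.of fun i j => g (a i + 1 - (i : ℕ) + (j : ℕ)) with hN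
  have h1 : ∀ i : Fin (n + 1), jtDet g (n + 1) (Function.update a i (a i + 1)) 0 =
      (M.updateRow i (N i)).det := by
    intro i
    unfold jtDet
    congr 1
    ext r c
    by_cases h : r = i
    · subst h; simp [hN]
    · have : (r : ℕ) ≠ i := fun e => h (Fin.ext e)
      simp [Matrix.updateRow_ne h, hM, Function.update_of_ne this]
  -- Column `j` of `N` is column `j + 1` of `M`, so only the replacement of the last column
  -- survives.
  have h2 : ∀ j : Fin n, (M.updateCol j.castSucc fun i => N i j.castSucc).det = 0 := by
    intro j
    refine Matrix.det_zero_of_column_eq (i := j.castSucc) (j := j.succ)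
      (Fin.castSucc_lt_succ).ne fun i => ?_
    rw [Matrix.updateCol_self, Matrix.updateCol_ne (Fin.castSucc_lt_succ).ne']
    simp only [hM, hN, Matrix.of_apply]
    congr 1
    push_cast [Fin.val_succ, Fin.val_castSucc]
    ring
  simp only [h1]
  rw [sum_det_updateRow_eq_sum_det_updateCol, Fin.sum_univ_castSucc, Finset.sum_eq_zero
    fun j _ => h2 j, zero_add, det_eq_mul_of_last_row]
  · rw [Matrix.updateCol_self]
    congr 1
    · simp [hN, ha]
    · unfold jtDet
      congr 1
      ext r c
      simp [hM]
  · intro j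
    rw [Matrix.updateCol_ne (Fin.castSucc_lt_last j).ne]
    simp only [hM, Matrix.of_apply, Fin.val_last, ha]
    apply hg
    simp

/-- The shift by `-i` makes rows `i` and `i + 1` coincide. This kills the increments that do not
lead to a partition. -/
theorem jtDet_eq_zero (g : ℤ → A) {n i : ℕ} (hi : i + 1 < n) {a : ℕ → ℤ}
    (h : a (i + 1) = a i + 1) : jtDet g n a 0 = 0 := by
  refine Matrix.det_zero_of_row_eq (i := ⟨i, by omega⟩) (j := ⟨i + 1, hi⟩) (by simp) ?_
  ext c
  simp only [Matrix.of_apply, h]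
  congr 1
  push_cast
  simp

/-- The recursion for the determinants attached to ribbons: `a', b'` arise from `a, b` by a new
first row with one cell, and `a''` by lengthening the first row by one cell. -/
theorem jtDet_add_jtDet {g : ℤ → A} (hg : ∀ d < 0, g d = 0) (g0 : g 0 = 1) {n : ℕ}
    {a b a' b' a'' : ℕ → ℤ} (ha : ∀ i, a i ≤ a 0)
    (ha0 : a' 0 = a 0) (hb0 : b' 0 = a 0 - 1) (has : ∀ i, a' (i + 1) = a i)
    (hbs : ∀ i, b' (i + 1) = b i) (h0 : a'' 0 = a 0 + 1) (hs : ∀ i, a'' (i + 1) = a (i + 1)) :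
    jtDet g (n + 2) a' b' + jtDet g (n + 1) a'' b = g 1 * jtDet g (n + 1) a b := by
  unfold jtDet
  -- The first column is `(g 1, g 0, 0, …, 0)`, so only two minors remain.
  rw [Matrix.det_succ_column_zero, Fin.sum_univ_succ, Fin.sum_univ_succ, Finset.sum_eq_zero]
  · have e1 : g (a' 0 - b' 0) = g 1 := by rw [ha0, hb0]; congr 1; ring
    have e2 : g (a' 1 - b' 0 - 1) = 1 := by
      rw [show (1 : ℕ) = 0 + 1 from rfl, has, hb0, ← g0]; congr 1; ring
    have e3 : ((Matrix.of fun i j : Fin (n + 2) => g (a' i - b' j - (i : ℕ) + (j : ℕ))).submatrix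
        (Fin.succAbove 0) Fin.succ) =
        Matrix.of fun i j : Fin (n + 1) => g (a i - b j - (i : ℕ) + (j : ℕ)) := by
      ext i j
      simp only [Matrix.submatrix_apply, Matrix.of_apply, Fin.zero_succAbove, Fin.val_succ, has,
        hbs]
      congr 1
      push_cast
      ring
    -- Deleting the second row leaves the new first row on top of the old rows from the second on;
    -- the column shift turns its `a 0` into `a 0 + 1`.
    have e4 : ((Matrix.of fun i j : Fin (n + 2) => g (a' i - b' j - (i : ℕ) + (j : ℕ))).submatrix
        (Fin.succAbove (Fin.succ 0)) Fin.succ) =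
        Matrix.of fun i j : Fin (n + 1) => g (a'' i - b j - (i : ℕ) + (j : ℕ)) := by
      ext i j
      refine Fin.cases ?_ (fun i => ?_) i
      · simp only [Matrix.submatrix_apply, Matrix.of_apply, Fin.succ_succAbove_zero, Fin.val_succ,
          hbs, Fin.val_zero, ha0, h0]
        congr 1
        push_cast
        ring
      · simp only [Matrix.submatrix_apply, Matrix.of_apply, Fin.succ_succAbove_succ, Fin.val_succ,
          hbs, Fin.zero_succAbove, has, hs]
        congr 1
        push_cast
        ring
    rw [e3, e4]
    simp [e1, e2]
  · intro i _
    have : g (a' (i + 2) - b' 0 - (i + 2)) = 0 := by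
      apply hg
      rw [show (i : ℕ) + 2 = (i + 1) + 1 from rfl, has, hb0]
      have := ha (i + 1)
      omega
    simp only [Matrix.of_apply, Fin.val_succ, Fin.val_zero]
    push_cast at this ⊢
    rw [show a' (↑i + 1 + 1) - b' 0 - ((i : ℤ) + 1 + 1) + 0 = a' (↑i + 2) - b' 0 - ((i : ℤ) + 2) by
      ring, this]
    simp

end Determinants

/-! ### Row and column lengths -/

theorem rowLen_eq_of_mem {mu : YoungDiagram} {i n : ℕ} (h : ∀ j, (i, j) ∈ mu ↔ j < n) :
    mu.rowLen i = n := by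
  simp only [YoungDiagram.mem_iff_lt_rowLen] at h
  exact eq_of_forall_lt_iff h

theorem colLen_eq_of_mem {mu : YoungDiagram} {j n : ℕ} (h : ∀ i, (i, j) ∈ mu ↔ i < n) :
    mu.colLen j = n := by
  simp only [YoungDiagram.mem_iff_lt_colLen] at h
  exact eq_of_forall_lt_iff h

theorem eq_bot_of_origin_notMem {mu : YoungDiagram} (h : (0, 0) ∉ mu) : mu = ⊥ := by
  refine SetLike.ext fun c => ⟨fun hc => absurd (mu.up_left_mem (Nat.zero_le c.1)
    (Nat.zero_le c.2) hc) h, fun hc => absurd hc (YoungDiagram.notMem_bot c)⟩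

/-! ### The rim of a Young diagram -/

/-- The cells `(i, j)` of `mu` for which `(i + 1, j + 1)` is not a cell. -/
def rim (mu : YoungDiagram) : Finset (ℕ × ℕ) :=
  mu.cells.filter fun c => (c.1 + 1, c.2 + 1) ∉ mu

theorem mem_rim {mu : YoungDiagram} {i j : ℕ} :
    (i, j) ∈ rim mu ↔ (i, j) ∈ mu ∧ (i + 1, j + 1) ∉ mu := by
  simp [rim]

/-- The skew shape formed by the rim. -/
def rimShape (mu : YoungDiagram) : SkewShape where
  outer := mu
  inner :=
    { cells := mu.cells.filter fun c => (c.1 + 1, c.2 + 1) ∈ mu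
      isLowerSet := by
        rintro ⟨a, b⟩ ⟨c, d⟩ ⟨h1, h2⟩ h
        simp only [Finset.coe_filter, Set.mem_ofPred_eq, YoungDiagram.mem_cells] at h ⊢
        exact ⟨mu.up_left_mem h1 h2 h.1,
          mu.up_left_mem (Nat.add_le_add_right h1 1) (Nat.add_le_add_right h2 1) h.2⟩ }
  le := by
    rw [← YoungDiagram.cells_subset_iff]
    exact Finset.filter_subset _ _

theorem mem_rimShape_inner {mu : YoungDiagram} {i j : ℕ} :
    (i, j) ∈ (rimShape mu).inner ↔ (i + 1, j + 1) ∈ mu := by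
  rw [← YoungDiagram.mem_cells]
  simp only [rimShape, Finset.mem_filter, YoungDiagram.mem_cells, and_iff_right_iff_imp]
  exact mu.up_left_mem (Nat.le_succ i) (Nat.le_succ j)

theorem rimShape_cells (mu : YoungDiagram) : (rimShape mu).cells = rim mu := by
  ext ⟨i, j⟩
  rw [SkewShape.cells, Finset.mem_sdiff, YoungDiagram.mem_cells, YoungDiagram.mem_cells,
    mem_rimShape_inner, mem_rim]
  rfl

/-- The inner diagram is `mu` without its first row and first column; truncated subtraction covers
empty rows. -/
theorem rimShape_inner_rowLen (mu : YoungDiagram) (i : ℕ) :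
    (rimShape mu).inner.rowLen i = mu.rowLen (i + 1) - 1 := by
  refine rowLen_eq_of_mem fun j => ?_
  rw [mem_rimShape_inner, YoungDiagram.mem_iff_lt_rowLen]
  omega

/-- From any rim cell, step right if possible and otherwise up. This stays on the rim and ends at
the last cell of the first row; reversing one such path joins any two cells. -/
theorem rimShape_connected (mu : YoungDiagram) : (rimShape mu).Connected := by
  unfold SkewShape.Connected
  rw [rimShape_cells]
  set r : ℕ × ℕ → ℕ × ℕ → Prop := fun a b => a ∈ rim mu ∧ b ∈ rim mu ∧ SkewShape.Adjacent a b
  have hsymm : ∀ a b, r a b → r b a := by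
    rintro a b ⟨h1, h2, h3⟩
    refine ⟨h2, h1, ?_⟩
    unfold SkewShape.Adjacent at h3 ⊢
    omega
  have key : ∀ n i j, (i, j) ∈ rim mu → i + (mu.rowLen 0 - j) = n →
      Relation.ReflTransGen r (i, j) (0, mu.rowLen 0 - 1) := by
    intro n
    induction n with
    | zero =>
      intro i j h hn
      have := YoungDiagram.mem_iff_lt_rowLen.1 (mem_rim.1 h).1
      have := mu.rowLen_anti 0 i (Nat.zero_le _)
      omega
    | succ n ih =>
      intro i j h hn
      obtain ⟨h1, h2⟩ := mem_rim.1 h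
      by_cases h3 : (i, j + 1) ∈ mu
      · have h4 : (i, j + 1) ∈ rim mu :=
          mem_rim.2 ⟨h3, fun h' => h2 (mu.up_left_mem le_rfl (Nat.le_succ _) h')⟩
        have := YoungDiagram.mem_iff_lt_rowLen.1 h3
        have := mu.rowLen_anti 0 i (Nat.zero_le _)
        exact .head ⟨h, h4, Or.inl ⟨rfl, Or.inl rfl⟩⟩ (ih i (j + 1) h4 (by omega))
      · cases i with
        | zero =>
          rw [YoungDiagram.mem_iff_lt_rowLen] at h1 h3
          rw [show mu.rowLen 0 - 1 = j by omega]
        | succ i =>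
          have h4 : (i, j) ∈ rim mu := mem_rim.2 ⟨mu.up_left_mem (Nat.le_succ _) le_rfl h1, h3⟩
          exact .head ⟨h, h4, Or.inr ⟨rfl, Or.inr rfl⟩⟩ (ih i j h4 (by omega))
  rintro ⟨a, b⟩ hc ⟨a', b'⟩ hd
  refine (key _ _ _ hc rfl).trans ?_
  have := key _ _ _ hd rfl
  rw [← Relation.reflTransGen_swap] at this
  exact Relation.ReflTransGen.mono (fun x y h => hsymm y x h) _ _ this

theorem rimShape_isRibbon (mu : YoungDiagram) : (rimShape mu).IsRibbon := by
  refine ⟨rimShape_connected mu, ?_⟩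
  rintro ⟨i, j, h1, -, -, h4⟩
  rw [rimShape_cells, mem_rim] at h1 h4
  exact h1.2 h4.1

theorem rimShape_isNormalized (mu : YoungDiagram) : (rimShape mu).IsNormalized := by
  constructor
  · ext i
    have : i < mu.colLen 0 ↔ 0 < mu.rowLen i := by
      rw [← YoungDiagram.mem_iff_lt_colLen, YoungDiagram.mem_iff_lt_rowLen]
    have := mu.rowLen_anti i (i + 1) (Nat.le_succ i)
    simp only [Set.mem_ofPred_eq, Set.mem_Iio, rimShape_inner_rowLen]
    change _ < mu.rowLen i ↔ i < mu.colLen 0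
    omega
  · ext j
    have h1 : j < mu.rowLen 0 ↔ 0 < mu.colLen j := by
      rw [← YoungDiagram.mem_iff_lt_colLen, YoungDiagram.mem_iff_lt_rowLen]
    have h2 := mu.colLen_anti j (j + 1) (Nat.le_succ j)
    have h3 : (rimShape mu).inner.colLen j = mu.colLen (j + 1) - 1 := by
      refine colLen_eq_of_mem fun i => ?_
      rw [mem_rimShape_inner, YoungDiagram.mem_iff_lt_colLen]
      omega
    simp only [Set.mem_ofPred_eq, Set.mem_Iio, h3]
    change _ < mu.colLen j ↔ j < mu.rowLen 0
    omega

/-- A normalized ribbon is the rim of its outer diagram. -/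
theorem eq_rimShape {R : SkewShape} (hR : R.IsRibbon) (hN : R.IsNormalized) :
    R = rimShape R.outer := by
  have hmem : ∀ i j, (i, j) ∈ R.cells ↔ (i, j) ∈ R.outer ∧ (i, j) ∉ R.inner := by
    intro i j
    simp [SkewShape.cells]
  refine SkewShape.ext rfl (SetLike.ext ?_)
  rintro ⟨i, j⟩
  rw [mem_rimShape_inner]
  constructor
  · intro h
    by_contra hn
    have ho : (i, j) ∈ R.outer := R.le h
    -- By normalization, row `i` and column `j` each contain a cell of the ribbon. These two cells
    -- turn out to lie in different components.
    have hr : R.inner.rowLen i < R.outer.rowLen i := by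
      have : i ∈ Set.Iio (R.outer.colLen 0) :=
        YoungDiagram.mem_iff_lt_colLen.1 (R.outer.up_left_mem le_rfl (Nat.zero_le j) ho)
      rwa [← hN.1] at this
    have hc : R.inner.colLen j < R.outer.colLen j := by
      have : j ∈ Set.Iio (R.outer.rowLen 0) :=
        YoungDiagram.mem_iff_lt_rowLen.1 (R.outer.up_left_mem (Nat.zero_le i) le_rfl ho)
      rwa [← hN.2] at this
    have h1 : (i, R.inner.rowLen i) ∈ R.cells := by
      rw [hmem, YoungDiagram.mem_iff_lt_rowLen, YoungDiagram.mem_iff_lt_rowLen]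
      exact ⟨hr, lt_irrefl _⟩
    have h2 : (R.inner.colLen j, j) ∈ R.cells := by
      rw [hmem, YoungDiagram.mem_iff_lt_colLen, YoungDiagram.mem_iff_lt_colLen]
      exact ⟨hc, lt_irrefl _⟩
    -- The ribbon splits into a part strictly right of column `j` in rows up to `i` and a part
    -- strictly below row `i` in columns up to `j`; no edge joins them.
    have hsplit : ∀ a b, (a, b) ∈ R.cells → (a ≤ i ∧ j < b) ∨ (i < a ∧ b ≤ j) := by
      intro a b hab
      rw [hmem] at hab
      by_contra hcon
      rcases le_or_gt a i with ha | ha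
      · exact hab.2 (R.inner.up_left_mem ha (by omega) h)
      · exact hn (R.outer.up_left_mem (show i + 1 ≤ a from ha) (by omega) hab.1)
    have hinv : ∀ c, Relation.ReflTransGen
        (fun a b => a ∈ R.cells ∧ b ∈ R.cells ∧ SkewShape.Adjacent a b)
        (i, R.inner.rowLen i) c → c.1 ≤ i := by
      intro c hc
      induction hc with
      | refl => exact le_rfl
      | tail _ hstep ih =>
        obtain ⟨h3, h4, h5⟩ := hstep
        have h3 := hsplit _ _ h3
        have h4 := hsplit _ _ h4
        unfold SkewShape.Adjacent at h5
        omega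
    have := hinv _ (hR.1 _ h1 _ h2)
    have := YoungDiagram.mem_iff_lt_colLen.1 h
    simp only at *
    omega
  -- Otherwise the four cells from `(i, j)` to `(i + 1, j + 1)` form a block.
  · intro h
    by_contra hn
    refine hR.2 ⟨i, j, ?_, ?_, ?_, ?_⟩ <;> rw [hmem]
    · exact ⟨R.outer.up_left_mem (Nat.le_succ _) (Nat.le_succ _) h, hn⟩
    · exact ⟨R.outer.up_left_mem (Nat.le_succ _) le_rfl h,
        fun h' => hn (R.inner.up_left_mem le_rfl (Nat.le_succ _) h')⟩
    · exact ⟨R.outer.up_left_mem le_rfl (Nat.le_succ _) h,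
        fun h' => hn (R.inner.up_left_mem (Nat.le_succ _) le_rfl h')⟩
    · exact ⟨h, fun h' => hn (R.inner.up_left_mem (Nat.le_succ _) (Nat.le_succ _) h')⟩

open Classical in
/-- The Young diagrams whose rim has `m` cells. -/
def diagramsOfRim (m : ℕ) : Finset YoungDiagram := (ribbons m).image SkewShape.outer

theorem mem_ribbons {m : ℕ} {R : SkewShape} :
    R ∈ ribbons m ↔ R = rimShape R.outer ∧ (rim R.outer).card = m := by
  simp only [ribbons, Set.Finite.mem_toFinset, Set.mem_ofPred_eq]
  constructor
  · rintro ⟨h1, h2, h3⟩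
    have h := eq_rimShape h1 h2
    refine ⟨h, ?_⟩
    rw [← rimShape_cells, ← h]
    exact h3
  · rintro ⟨h1, h2⟩
    rw [h1]
    refine ⟨rimShape_isRibbon _, rimShape_isNormalized _, ?_⟩
    rw [SkewShape.size, rimShape_cells, h2]

theorem mem_diagramsOfRim {m : ℕ} {mu : YoungDiagram} :
    mu ∈ diagramsOfRim m ↔ (rim mu).card = m := by
  simp only [diagramsOfRim, Finset.mem_image, mem_ribbons]
  constructor
  · rintro ⟨R, ⟨-, h⟩, rfl⟩
    exact h
  · intro h
    exact ⟨rimShape mu, ⟨rfl, h⟩, rfl⟩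

theorem sum_ribbons {A : Type*} [AddCommMonoid A] (m : ℕ) (f : SkewShape → A) :
    ∑ R ∈ ribbons m, f R = ∑ mu ∈ diagramsOfRim m, f (rimShape mu) := by
  classical
  rw [diagramsOfRim, Finset.sum_image]
  · refine Finset.sum_congr rfl fun R hR => ?_
    rw [← (mem_ribbons.1 hR).1]
  · intro R hR S hS h
    rw [(mem_ribbons.1 hR).1, (mem_ribbons.1 hS).1, h]

/-! ### Growing a rim by one cell -/

/-- Repeat the first row. -/
def repeatRow (mu : YoungDiagram) : YoungDiagram where
  cells := mu.cells ∪ mu.cells.image fun c => (c.1 + 1, c.2)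
  isLowerSet := by
    rintro ⟨a, b⟩ ⟨c, d⟩ ⟨h1, h2⟩ h
    simp only [Finset.coe_union, Finset.coe_image, Set.mem_union, Set.mem_image, Finset.mem_coe,
      YoungDiagram.mem_cells, Prod.exists, Prod.mk.injEq] at h ⊢
    simp only at h1 h2
    rcases h with h | ⟨a, b, h, rfl, rfl⟩
    · exact Or.inl (mu.up_left_mem h1 h2 h)
    · cases c with
      | zero => exact Or.inl (mu.up_left_mem (Nat.zero_le _) h2 h)
      | succ c => exact Or.inr ⟨c, d, mu.up_left_mem (by omega) h2 h, rfl, rfl⟩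

theorem mem_repeatRow_zero {mu : YoungDiagram} {j : ℕ} : (0, j) ∈ repeatRow mu ↔ (0, j) ∈ mu := by
  rw [← YoungDiagram.mem_cells]
  simp [repeatRow]

theorem mem_repeatRow_succ {mu : YoungDiagram} {i j : ℕ} :
    (i + 1, j) ∈ repeatRow mu ↔ (i, j) ∈ mu := by
  rw [← YoungDiagram.mem_cells]
  simp only [repeatRow, Finset.mem_union, YoungDiagram.mem_cells, Finset.mem_image, Prod.mk.injEq,
    Nat.add_right_cancel_iff, Prod.exists, exists_eq_right_right, exists_eq_right]
  exact ⟨fun h => h.elim (mu.up_left_mem (Nat.le_succ i) le_rfl) id, Or.inr⟩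

/-- Remove the first row. -/
def dropRow (mu : YoungDiagram) : YoungDiagram where
  cells := mu.cells.filter fun c => (c.1 + 1, c.2) ∈ mu
  isLowerSet := by
    rintro ⟨a, b⟩ ⟨c, d⟩ ⟨h1, h2⟩ h
    simp only [Finset.coe_filter, Set.mem_ofPred_eq, YoungDiagram.mem_cells] at h ⊢
    exact ⟨mu.up_left_mem h1 h2 h.1, mu.up_left_mem (Nat.add_le_add_right h1 1) h2 h.2⟩

theorem mem_dropRow {mu : YoungDiagram} {i j : ℕ} : (i, j) ∈ dropRow mu ↔ (i + 1, j) ∈ mu := by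
  rw [← YoungDiagram.mem_cells]
  simp only [dropRow, Finset.mem_filter, YoungDiagram.mem_cells, and_iff_right_iff_imp]
  exact mu.up_left_mem (Nat.le_succ i) le_rfl

/-- Lengthen the first row by one cell. -/
def growRow (mu : YoungDiagram) : YoungDiagram where
  cells := insert (0, mu.rowLen 0) mu.cells
  isLowerSet := by
    rintro ⟨a, b⟩ ⟨c, d⟩ ⟨h1, h2⟩ h
    simp only [Finset.coe_insert, Set.mem_insert_iff, Finset.mem_coe, YoungDiagram.mem_cells,
      Prod.mk.injEq] at h ⊢
    simp only at h1 h2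
    rcases h with ⟨rfl, rfl⟩ | h
    · obtain rfl : c = 0 := by omega
      rw [YoungDiagram.mem_iff_lt_rowLen]
      omega
    · exact Or.inr (mu.up_left_mem h1 h2 h)

theorem mem_growRow_zero {mu : YoungDiagram} {j : ℕ} :
    (0, j) ∈ growRow mu ↔ j ≤ mu.rowLen 0 := by
  rw [← YoungDiagram.mem_cells]
  simp only [growRow, Finset.mem_insert, Prod.mk.injEq, true_and, YoungDiagram.mem_cells,
    YoungDiagram.mem_iff_lt_rowLen]
  omega

theorem mem_growRow_succ {mu : YoungDiagram} {i j : ℕ} :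
    (i + 1, j) ∈ growRow mu ↔ (i + 1, j) ∈ mu := by
  rw [← YoungDiagram.mem_cells]
  simp [growRow]

/-- Shorten the first row by one cell, if it is longer than the second. -/
def shrinkRow (mu : YoungDiagram) : YoungDiagram where
  cells := mu.cells.filter fun c => (0, c.2 + 1) ∈ mu ∨ (1, c.2) ∈ mu
  isLowerSet := by
    rintro ⟨a, b⟩ ⟨c, d⟩ ⟨h1, h2⟩ h
    simp only [Finset.coe_filter, Set.mem_ofPred_eq, YoungDiagram.mem_cells] at h ⊢
    exact ⟨mu.up_left_mem h1 h2 h.1, h.2.imp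
      (mu.up_left_mem le_rfl (Nat.add_le_add_right h2 1)) (mu.up_left_mem le_rfl h2)⟩

theorem mem_shrinkRow_zero {mu : YoungDiagram} {j : ℕ} :
    (0, j) ∈ shrinkRow mu ↔ (0, j + 1) ∈ mu ∨ (1, j) ∈ mu := by
  rw [← YoungDiagram.mem_cells]
  simp only [shrinkRow, Finset.mem_filter, YoungDiagram.mem_cells, and_iff_right_iff_imp]
  exact fun h => h.elim (mu.up_left_mem le_rfl (Nat.le_succ j))
    (mu.up_left_mem (Nat.zero_le 1) le_rfl)

theorem mem_shrinkRow_succ {mu : YoungDiagram} {i j : ℕ} :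
    (i + 1, j) ∈ shrinkRow mu ↔ (i + 1, j) ∈ mu := by
  rw [← YoungDiagram.mem_cells]
  simp only [shrinkRow, Finset.mem_filter, YoungDiagram.mem_cells, and_iff_left_iff_imp]
  exact fun h => Or.inr (mu.up_left_mem (Nat.le_add_left 1 i) le_rfl h)

theorem dropRow_repeatRow (mu : YoungDiagram) : dropRow (repeatRow mu) = mu := by
  refine SetLike.ext fun ⟨i, j⟩ => ?_
  rw [mem_dropRow, mem_repeatRow_succ]

theorem repeatRow_dropRow {mu : YoungDiagram} (h : mu.rowLen 1 = mu.rowLen 0) :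
    repeatRow (dropRow mu) = mu := by
  refine SetLike.ext fun ⟨i, j⟩ => ?_
  cases i with
  | zero =>
    rw [mem_repeatRow_zero, mem_dropRow, YoungDiagram.mem_iff_lt_rowLen, h,
      YoungDiagram.mem_iff_lt_rowLen]
  | succ i => rw [mem_repeatRow_succ, mem_dropRow]

theorem shrinkRow_growRow (mu : YoungDiagram) : shrinkRow (growRow mu) = mu := by
  refine SetLike.ext fun ⟨i, j⟩ => ?_
  cases i with
  | zero =>
    have := mu.rowLen_anti 0 1 (Nat.zero_le 1)
    rw [mem_shrinkRow_zero, mem_growRow_zero, mem_growRow_succ, YoungDiagram.mem_iff_lt_rowLen,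
      YoungDiagram.mem_iff_lt_rowLen]
    simp only [zero_add]
    omega
  | succ i => rw [mem_shrinkRow_succ, mem_growRow_succ]

theorem shrinkRow_rowLen_zero {mu : YoungDiagram} (h : mu.rowLen 1 ≠ mu.rowLen 0) :
    (shrinkRow mu).rowLen 0 = mu.rowLen 0 - 1 := by
  have := mu.rowLen_anti 0 1 (Nat.zero_le 1)
  refine rowLen_eq_of_mem fun j => ?_
  rw [mem_shrinkRow_zero, YoungDiagram.mem_iff_lt_rowLen, YoungDiagram.mem_iff_lt_rowLen]
  omega

theorem growRow_shrinkRow {mu : YoungDiagram} (h : mu.rowLen 1 ≠ mu.rowLen 0) :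
    growRow (shrinkRow mu) = mu := by
  have := mu.rowLen_anti 0 1 (Nat.zero_le 1)
  refine SetLike.ext fun ⟨i, j⟩ => ?_
  cases i with
  | zero =>
    rw [mem_growRow_zero, shrinkRow_rowLen_zero h, YoungDiagram.mem_iff_lt_rowLen]
    omega
  | succ i => rw [mem_growRow_succ, mem_shrinkRow_succ]

theorem repeatRow_rowLen_zero (mu : YoungDiagram) : (repeatRow mu).rowLen 0 = mu.rowLen 0 :=
  rowLen_eq_of_mem fun j => by rw [mem_repeatRow_zero, YoungDiagram.mem_iff_lt_rowLen]

theorem repeatRow_rowLen_succ (mu : YoungDiagram) (i : ℕ) :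
    (repeatRow mu).rowLen (i + 1) = mu.rowLen i :=
  rowLen_eq_of_mem fun j => by rw [mem_repeatRow_succ, YoungDiagram.mem_iff_lt_rowLen]

theorem growRow_rowLen_zero (mu : YoungDiagram) : (growRow mu).rowLen 0 = mu.rowLen 0 + 1 :=
  rowLen_eq_of_mem fun j => by rw [mem_growRow_zero, Nat.lt_succ_iff]

theorem growRow_rowLen_succ (mu : YoungDiagram) (i : ℕ) :
    (growRow mu).rowLen (i + 1) = mu.rowLen (i + 1) :=
  rowLen_eq_of_mem fun j => by rw [mem_growRow_succ, YoungDiagram.mem_iff_lt_rowLen]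

theorem repeatRow_colLen_zero {mu : YoungDiagram} (h : (0, 0) ∈ mu) :
    (repeatRow mu).colLen 0 = mu.colLen 0 + 1 := by
  refine colLen_eq_of_mem fun i => ?_
  cases i with
  | zero => simpa [mem_repeatRow_zero] using h
  | succ i => rw [mem_repeatRow_succ, YoungDiagram.mem_iff_lt_colLen, Nat.add_lt_add_iff_right]

theorem growRow_colLen_zero {mu : YoungDiagram} (h : (0, 0) ∈ mu) :
    (growRow mu).colLen 0 = mu.colLen 0 := by
  refine colLen_eq_of_mem fun i => ?_
  cases i with
  | zero =>
    rw [← YoungDiagram.mem_iff_lt_colLen]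
    simpa [mem_growRow_zero] using h
  | succ i => rw [mem_growRow_succ, YoungDiagram.mem_iff_lt_colLen]

/-- The new cell lies on the rim, and it is not the diagonal successor of any cell, so no old rim
cell is lost. -/
theorem card_rim_growRow (mu : YoungDiagram) : (rim (growRow mu)).card = (rim mu).card + 1 := by
  have : rim (growRow mu) = insert (0, mu.rowLen 0) (rim mu) := by
    ext ⟨i, j⟩
    rw [Finset.mem_insert, mem_rim, mem_rim, mem_growRow_succ, Prod.mk.injEq]
    cases i with
    | zero =>
      have := mu.rowLen_anti 0 1 (Nat.zero_le 1)
      rw [mem_growRow_zero, YoungDiagram.mem_iff_lt_rowLen, YoungDiagram.mem_iff_lt_rowLen]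
      simp only [zero_add, true_and]
      omega
    | succ i => simp [mem_growRow_succ]
  rw [this, Finset.card_insert_of_notMem]
  simp [mem_rim, YoungDiagram.mem_iff_lt_rowLen]

/-- The old rim moves down by one row, and the new first row contributes only its last cell. -/
theorem card_rim_repeatRow {mu : YoungDiagram} (h : (0, 0) ∈ mu) :
    (rim (repeatRow mu)).card = (rim mu).card + 1 := by
  have : rim (repeatRow mu) =
      insert (0, mu.rowLen 0 - 1) ((rim mu).image fun c => (c.1 + 1, c.2)) := by
    ext ⟨i, j⟩
    rw [Finset.mem_insert, mem_rim, mem_repeatRow_succ, Prod.mk.injEq]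
    rw [YoungDiagram.mem_iff_lt_rowLen] at h
    cases i with
    | zero =>
      rw [mem_repeatRow_zero, YoungDiagram.mem_iff_lt_rowLen, YoungDiagram.mem_iff_lt_rowLen]
      simp
      omega
    | succ i => simp [mem_repeatRow_succ, mem_rim]
  rw [this, Finset.card_insert_of_notMem (by simp), Finset.card_image_of_injective]
  rintro ⟨a, b⟩ ⟨c, d⟩ h
  simpa using h

theorem origin_mem_of_card_rim_ne_zero {mu : YoungDiagram} (h : (rim mu).card ≠ 0) :
    (0, 0) ∈ mu := by
  by_contra h0
  rw [eq_bot_of_origin_notMem h0] at h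
  exact h rfl

theorem eq_bot_of_card_rim_eq_zero {mu : YoungDiagram} (h : (rim mu).card = 0) : mu = ⊥ := by
  refine eq_bot_of_origin_notMem fun h0 => ?_
  have h1 : (0, mu.rowLen 0 - 1) ∈ rim mu := by
    have := mu.rowLen_anti 0 1 (Nat.zero_le 1)
    rw [YoungDiagram.mem_iff_lt_rowLen] at h0
    rw [mem_rim, YoungDiagram.mem_iff_lt_rowLen, YoungDiagram.mem_iff_lt_rowLen]
    simp only [zero_add]
    omega
  rw [Finset.card_eq_zero.1 h] at h1
  simp at h1

theorem diagramsOfRim_zero : diagramsOfRim 0 = {⊥} := by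
  ext mu
  rw [mem_diagramsOfRim, Finset.mem_singleton]
  exact ⟨eq_bot_of_card_rim_eq_zero, fun h => h ▸ rfl⟩

theorem origin_mem_dropRow {mu : YoungDiagram} (h0 : (0, 0) ∈ mu)
    (h : mu.rowLen 1 = mu.rowLen 0) : (0, 0) ∈ dropRow mu := by
  rw [mem_dropRow, YoungDiagram.mem_iff_lt_rowLen, h, ← YoungDiagram.mem_iff_lt_rowLen]
  exact h0

/-- Size one needs separate treatment because `repeatRow` fixes the empty diagram. -/
theorem diagramsOfRim_one : diagramsOfRim 1 = {growRow ⊥} := by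
  ext mu
  rw [mem_diagramsOfRim, Finset.mem_singleton]
  constructor
  · intro h
    have h0 := origin_mem_of_card_rim_ne_zero (mu := mu) (by omega)
    by_cases hr : mu.rowLen 1 = mu.rowLen 0
    · have h1 := origin_mem_dropRow h0 hr
      have h2 := card_rim_repeatRow h1
      rw [repeatRow_dropRow hr, h] at h2
      rw [eq_bot_of_card_rim_eq_zero (mu := dropRow mu) (by omega)] at h1
      exact absurd h1 (YoungDiagram.notMem_bot _)
    · have h2 := card_rim_growRow (shrinkRow mu)
      rw [growRow_shrinkRow hr, h] at h2
      rw [← growRow_shrinkRow hr, eq_bot_of_card_rim_eq_zero (mu := shrinkRow mu) (by omega)]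
  · rintro rfl
    rw [card_rim_growRow]
    rfl

/-- Whether the first two rows have equal length decides which operation came last, and that
operation can be undone. -/
theorem sum_diagramsOfRim_succ {A : Type*} [AddCommMonoid A] {m : ℕ} (hm : m ≠ 0)
    (f : YoungDiagram → A) :
    ∑ mu ∈ diagramsOfRim (m + 1), f mu =
      ∑ mu ∈ diagramsOfRim m, (f (repeatRow mu) + f (growRow mu)) := by
  rw [← Finset.sum_filter_add_sum_filter_not _ fun mu => mu.rowLen 1 = mu.rowLen 0,
    Finset.sum_add_distrib]
  congr 1
  · refine Finset.sum_bij' (fun mu _ => dropRow mu) (fun mu _ => repeatRow mu) ?_ ?_ ?_ ?_ ?_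
    · intro mu h
      rw [Finset.mem_filter, mem_diagramsOfRim] at h
      have h0 := origin_mem_of_card_rim_ne_zero (mu := mu) (by omega)
      have h1 := card_rim_repeatRow (origin_mem_dropRow h0 h.2)
      rw [repeatRow_dropRow h.2] at h1
      rw [mem_diagramsOfRim]
      omega
    · intro mu h
      rw [mem_diagramsOfRim] at h
      have h0 := origin_mem_of_card_rim_ne_zero (mu := mu) (by omega)
      rw [Finset.mem_filter, mem_diagramsOfRim, card_rim_repeatRow h0, h, repeatRow_rowLen_zero,
        repeatRow_rowLen_succ]
      exact ⟨rfl, rfl⟩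
    · intro mu h
      exact repeatRow_dropRow (Finset.mem_filter.1 h).2
    · intro mu _
      exact dropRow_repeatRow mu
    · intro mu h
      rw [repeatRow_dropRow (Finset.mem_filter.1 h).2]
  · refine Finset.sum_bij' (fun mu _ => shrinkRow mu) (fun mu _ => growRow mu) ?_ ?_ ?_ ?_ ?_
    · intro mu h
      rw [Finset.mem_filter, mem_diagramsOfRim] at h
      have h1 := card_rim_growRow (shrinkRow mu)
      rw [growRow_shrinkRow h.2] at h1
      rw [mem_diagramsOfRim]
      omega
    · intro mu h
      rw [mem_diagramsOfRim] at h
      have := mu.rowLen_anti 0 1 (Nat.zero_le 1)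
      rw [Finset.mem_filter, mem_diagramsOfRim, card_rim_growRow, h, growRow_rowLen_zero,
        growRow_rowLen_succ]
      exact ⟨rfl, by simp only [zero_add]; omega⟩
    · intro mu h
      exact growRow_shrinkRow (Finset.mem_filter.1 h).2
    · intro mu _
      exact shrinkRow_growRow mu
    · intro mu h
      rw [growRow_shrinkRow (Finset.mem_filter.1 h).2]

/-! ### Sums of ribbon determinants -/

section RibbonDeterminants

variable {A : Type*} [CommRing A]

/-- The Jacobi--Trudi determinant of a skew shape over a sequence `g`. -/
def skewDet (g : ℤ → A) (R : SkewShape) : A :=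
  jtDet g (R.outer.colLen 0) (fun i => R.outer.rowLen i) (fun i => R.inner.rowLen i)

theorem skewDet_repeatRow_add_skewDet_growRow {g : ℤ → A} (hg : ∀ d < 0, g d = 0) (g0 : g 0 = 1)
    {mu : YoungDiagram} (h : (0, 0) ∈ mu) :
    skewDet g (rimShape (repeatRow mu)) + skewDet g (rimShape (growRow mu)) =
      g 1 * skewDet g (rimShape mu) := by
  obtain ⟨n, hn⟩ : ∃ n, mu.colLen 0 = n + 1 :=
    Nat.exists_eq_succ_of_ne_zero (YoungDiagram.mem_iff_lt_colLen.1 h).ne'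
  have hpos := YoungDiagram.mem_iff_lt_rowLen.1 h
  -- The inner diagram depends only on the rows below the first, which `growRow` leaves alone.
  have hb : (fun i => ((rimShape (growRow mu)).inner.rowLen i : ℤ)) =
      fun i => ((rimShape mu).inner.rowLen i : ℤ) := by
    ext i
    rw [rimShape_inner_rowLen, rimShape_inner_rowLen, growRow_rowLen_succ]
  unfold skewDet
  rw [hb]
  change jtDet g ((repeatRow mu).colLen 0) (fun i => (repeatRow mu).rowLen i) _ +
    jtDet g ((growRow mu).colLen 0) (fun i => (growRow mu).rowLen i) _ =
    g 1 * jtDet g (mu.colLen 0) (fun i => mu.rowLen i) _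
  rw [repeatRow_colLen_zero h, growRow_colLen_zero h, hn]
  apply jtDet_add_jtDet hg g0
  · intro i
    exact_mod_cast mu.rowLen_anti 0 i (Nat.zero_le i)
  · rw [repeatRow_rowLen_zero]
  · rw [rimShape_inner_rowLen, repeatRow_rowLen_succ]
    omega
  · intro i
    rw [repeatRow_rowLen_succ]
  · intro i
    rw [rimShape_inner_rowLen, rimShape_inner_rowLen, repeatRow_rowLen_succ]
  · rw [growRow_rowLen_zero]
    push_cast
    rfl
  · intro i
    rw [growRow_rowLen_succ]

theorem bot_rowLen (i : ℕ) : (⊥ : YoungDiagram).rowLen i = 0 :=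
  rowLen_eq_of_mem fun j => by simp

theorem bot_colLen (i : ℕ) : (⊥ : YoungDiagram).colLen i = 0 :=
  colLen_eq_of_mem fun j => by simp

theorem skewDet_rimShape_bot (g : ℤ → A) : skewDet g (rimShape ⊥) = 1 := by
  unfold skewDet
  change jtDet g ((⊥ : YoungDiagram).colLen 0) _ _ = 1
  rw [bot_colLen]
  exact Matrix.det_fin_zero

theorem skewDet_rimShape_growRow_bot (g : ℤ → A) : skewDet g (rimShape (growRow ⊥)) = g 1 := by
  have h : (growRow ⊥).colLen 0 = 1 := by
    refine colLen_eq_of_mem fun i => ?_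
    cases i with
    | zero => simp [mem_growRow_zero]
    | succ i => simp [mem_growRow_succ]
  unfold skewDet
  change jtDet g ((growRow ⊥).colLen 0) (fun i => (growRow ⊥).rowLen i) _ = g 1
  rw [h, jtDet, Matrix.det_fin_one]
  simp [rimShape_inner_rowLen, growRow_rowLen_zero, growRow_rowLen_succ, bot_rowLen]

/-- The sum of all ribbon determinants of size `m` is `g 1 ^ m`. -/
theorem sum_skewDet_ribbons {g : ℤ → A} (hg : ∀ d < 0, g d = 0) (g0 : g 0 = 1) (m : ℕ) :
    ∑ R ∈ ribbons m, skewDet g R = g 1 ^ m := by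
  rw [sum_ribbons]
  induction m with
  | zero => rw [diagramsOfRim_zero, Finset.sum_singleton, skewDet_rimShape_bot, pow_zero]
  | succ m ih =>
    rcases eq_or_ne m 0 with rfl | hm
    · rw [diagramsOfRim_one, Finset.sum_singleton, skewDet_rimShape_growRow_bot, zero_add, pow_one]
    · rw [sum_diagramsOfRim_succ hm, pow_succ', ← ih, Finset.mul_sum]
      refine Finset.sum_congr rfl fun mu h => ?_
      rw [mem_diagramsOfRim] at h
      exact skewDet_repeatRow_add_skewDet_growRow hg g0
        (origin_mem_of_card_rim_ne_zero (by omega))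

end RibbonDeterminants

/-! ### Removing the largest entry of a standard tableau -/

theorem mem_partitionsOf {m : ℕ} {mu : YoungDiagram} : mu ∈ partitionsOf m ↔ mu.card = m := by
  simp [partitionsOf]

theorem finite_standard (mu : YoungDiagram) :
    Finite {T : SemistandardYoungTableau mu // IsStandard T} := by
  have hT : ∀ T : {T : SemistandardYoungTableau mu // IsStandard T}, ∀ c : mu.cells,
      T.1 c.1.1 c.1.2 < mu.card + 1 := fun T c =>
    Nat.lt_succ_iff.2 (Set.mem_Icc.1 (T.2.mapsTo c.2)).2
  refine Finite.of_injective (β := mu.cells → Fin (mu.card + 1)) (fun T c => ⟨_, hT T c⟩) ?_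
  intro T T' h
  refine Subtype.ext (SemistandardYoungTableau.ext fun i j => ?_)
  by_cases hc : (i, j) ∈ mu
  · have := congrFun h ⟨(i, j), hc⟩
    simpa using this
  · rw [T.1.zeros hc, T'.1.zeros hc]

theorem exists_cells_eq_insert {mu lam : YoungDiagram} (hle : mu ≤ lam)
    (hcard : lam.card = mu.card + 1) :
    ∃ c, c ∉ mu.cells ∧ lam.cells = insert c mu.cells := by
  have hsub := YoungDiagram.cells_subset_iff.2 hle
  have h1 : (lam.cells \ mu.cells).card = 1 := by
    rw [Finset.card_sdiff_of_subset hsub]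
    unfold YoungDiagram.card at hcard
    omega
  obtain ⟨c, hc⟩ := Finset.card_eq_one.1 h1
  have hc' : c ∈ lam.cells \ mu.cells := hc ▸ Finset.mem_singleton_self c
  refine ⟨c, (Finset.mem_sdiff.1 hc').2, ?_⟩
  rw [← Finset.sdiff_union_of_subset hsub, hc]
  rfl

/-- Extend a tableau of shape `mu` to `lam` by a constant that bounds its entries strictly. -/
def extendTableau {mu lam : YoungDiagram} (hcard : lam.card = mu.card + 1)
    (hle : mu ≤ lam) (T : {T : SemistandardYoungTableau mu // IsStandard T}) :
    SemistandardYoungTableau lam where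
  entry i j := if (i, j) ∈ mu then T.1 i j else if (i, j) ∈ lam then mu.card + 1 else 0
  row_weak' := by
    intro i j1 j2 hj h
    by_cases h2 : (i, j2) ∈ mu
    · rw [if_pos h2, if_pos (mu.up_left_mem le_rfl hj.le h2)]
      exact T.1.row_weak hj h2
    · rw [if_neg h2, if_pos h]
      split_ifs with h3
      · exact ((T.2.mapsTo h3).2).trans (Nat.le_succ _)
      · exact le_rfl
      · exact Nat.zero_le _
  col_strict' := by
    intro i1 i2 j hi h
    by_cases h2 : (i2, j) ∈ mu
    · rw [if_pos h2, if_pos (mu.up_left_mem hi.le le_rfl h2)]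
      exact T.1.col_strict hi h2
    · rw [if_neg h2, if_pos h]
      split_ifs with h3 h4
      · exact Nat.lt_succ_iff.2 (T.2.mapsTo h3).2
      -- Two different cells outside `mu` in one column are impossible, since only one cell is new.
      · obtain ⟨c, -, hc⟩ := exists_cells_eq_insert hle hcard
        rw [← YoungDiagram.mem_cells, hc, Finset.mem_insert, YoungDiagram.mem_cells] at h h4
        have e1 := h.resolve_right h2
        have e2 := h4.resolve_right h3
        rw [← e2, Prod.mk.injEq] at e1
        omega
      · exact Nat.succ_pos _
  zeros' := by
    intro i j h
    rw [if_neg fun h' => h (hle h'), if_neg h]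

theorem extendTableau_apply {mu lam : YoungDiagram} (hcard : lam.card = mu.card + 1)
    (hle : mu ≤ lam) (T : {T : SemistandardYoungTableau mu // IsStandard T}) (i j : ℕ) :
    extendTableau hcard hle T i j =
      if (i, j) ∈ mu then T.1 i j else if (i, j) ∈ lam then mu.card + 1 else 0 := rfl

theorem isStandard_extendTableau {mu lam : YoungDiagram} (hcard : lam.card = mu.card + 1)
    (hle : mu ≤ lam) (T : {T : SemistandardYoungTableau mu // IsStandard T}) :
    IsStandard (extendTableau hcard hle T) := by
  obtain ⟨c, hc, hins⟩ := exists_cells_eq_insert hle hcard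
  have hcl : c ∈ lam := by
    rw [← YoungDiagram.mem_cells, hins]
    exact Finset.mem_insert_self _ _
  have h1 : Set.BijOn (fun c : ℕ × ℕ => extendTableau hcard hle T c.1 c.2) mu.cells
      (Set.Icc 1 mu.card) := by
    refine T.2.congr fun d hd => ?_
    exact (if_pos hd).symm
  have h2 : extendTableau hcard hle T c.1 c.2 = mu.card + 1 := by
    exact (if_neg hc).trans (if_pos hcl)
  have h3 := h1.insert (a := c) (by simp only [h2]; simp)
  unfold IsStandard
  rw [hins, Finset.coe_insert, hcard]
  convert! h3 using 1
  simp only [h2]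
  ext x
  simp only [Set.mem_Icc, Set.mem_insert_iff]
  omega

/-- The cells of a standard tableau whose entries are at most `m`. -/
def sublevelDiagram {lam : YoungDiagram} (S : SemistandardYoungTableau lam) (m : ℕ) :
    YoungDiagram where
  cells := lam.cells.filter fun c => S c.1 c.2 ≤ m
  isLowerSet := by
    rintro ⟨a, b⟩ ⟨c, d⟩ ⟨h1, h2⟩ h
    simp only [Finset.coe_filter, Set.mem_ofPred_eq, YoungDiagram.mem_cells] at h ⊢
    exact ⟨lam.up_left_mem h1 h2 h.1, (S.col_weak h1 (lam.up_left_mem le_rfl h2 h.1)).trans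
      ((S.row_weak_of_le h2 h.1).trans h.2)⟩

theorem mem_sublevelDiagram {lam : YoungDiagram} {S : SemistandardYoungTableau lam} {m : ℕ}
    {c : ℕ × ℕ} : c ∈ sublevelDiagram S m ↔ c ∈ lam ∧ S c.1 c.2 ≤ m := by
  rw [← YoungDiagram.mem_cells]
  simp [sublevelDiagram]

theorem sublevelDiagram_le {lam : YoungDiagram} (S : SemistandardYoungTableau lam) (m : ℕ) :
    sublevelDiagram S m ≤ lam :=
  fun _ h => (mem_sublevelDiagram.1 h).1

theorem bijOn_sublevelDiagram {lam : YoungDiagram} {S : SemistandardYoungTableau lam}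
    (hS : IsStandard S) {m : ℕ} (hm : m ≤ lam.card) :
    Set.BijOn (fun c : ℕ × ℕ => S c.1 c.2) (sublevelDiagram S m).cells (Set.Icc 1 m) := by
  have h := Set.BijOn.subset_right hS (Set.Icc_subset_Icc_right hm)
  convert! h using 1
  ext c
  simp only [Finset.mem_coe, YoungDiagram.mem_cells, mem_sublevelDiagram, Set.mem_inter_iff,
    Set.mem_preimage, Set.mem_Icc, and_congr_right_iff]
  exact fun hc => ⟨fun h => ⟨(hS.mapsTo hc).1, h⟩, And.right⟩

theorem card_sublevelDiagram {lam : YoungDiagram} {S : SemistandardYoungTableau lam}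
    (hS : IsStandard S) {m : ℕ} (hm : m ≤ lam.card) : (sublevelDiagram S m).card = m := by
  have h := bijOn_sublevelDiagram hS hm
  have h2 := Finset.card_nbij (s := (sublevelDiagram S m).cells) (t := Finset.Icc 1 m)
    (fun c : ℕ × ℕ => S c.1 c.2) (fun c hc => by simpa using h.mapsTo hc) h.injOn
    (by rw [Finset.coe_Icc]; exact h.surjOn)
  simpa using h2

/-- The restriction of a tableau to a smaller shape. -/
def restrictTableau {mu lam : YoungDiagram} (hle : mu ≤ lam) (S : SemistandardYoungTableau lam) :
    SemistandardYoungTableau mu where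
  entry i j := if (i, j) ∈ mu then S i j else 0
  row_weak' := by
    intro i j1 j2 hj h
    rw [if_pos h, if_pos (mu.up_left_mem le_rfl hj.le h)]
    exact S.row_weak hj (hle h)
  col_strict' := by
    intro i1 i2 j hi h
    rw [if_pos h, if_pos (mu.up_left_mem hi.le le_rfl h)]
    exact S.col_strict hi (hle h)
  zeros' := fun h => if_neg h

open Classical in
-- Branching rule: deleting the cell of the largest entry `m + 1` is inverse to `extendTableau`.
theorem numSYT_eq_sum {m : ℕ} {lam : YoungDiagram} (hlam : lam.card = m + 1) :
    numSYT lam = ∑ mu ∈ (partitionsOf m).filter (· ≤ lam), numSYT mu := by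
  have hmem : ∀ {mu}, mu ∈ (partitionsOf m).filter (· ≤ lam) ↔ mu.card = m ∧ mu ≤ lam := by
    intro mu
    rw [Finset.mem_filter, mem_partitionsOf]
  have hcard : ∀ x : {mu // mu ∈ (partitionsOf m).filter (· ≤ lam)},
      lam.card = x.1.card + 1 := fun x => by rw [(hmem.1 x.2).1, hlam]
  have := finite_standard
  rw [← Finset.sum_coe_sort]
  unfold numSYT
  rw [← Nat.card_sigma]
  symm
  refine Nat.card_eq_of_bijective (fun x => ⟨extendTableau (hcard x.1) (hmem.1 x.1.2).2 x.2,
    isStandard_extendTableau _ _ _⟩) ⟨?_, ?_⟩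
  · rintro ⟨⟨mu, hmu⟩, T⟩ ⟨⟨nu, hnu⟩, U⟩ h
    have hc : mu.card = nu.card := by rw [(hmem.1 hmu).1, (hmem.1 hnu).1]
    have happ : ∀ i j, _ = _ := fun i j =>
      congrArg (fun S : {S : SemistandardYoungTableau lam // IsStandard S} => S.1 i j) h
    simp only [extendTableau_apply, ← hc] at happ
    -- The smaller shape is recovered from the extension: its entries stay below the value `mu.card
    -- + 1` given to the new cell.
    have key : ∀ {mu nu : YoungDiagram} (T : {T : SemistandardYoungTableau mu // IsStandard T})
        (U : {T : SemistandardYoungTableau nu // IsStandard T}), mu.card = nu.card → mu ≤ lam →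
        (∀ i j, (if (i, j) ∈ mu then T.1 i j else if (i, j) ∈ lam then mu.card + 1 else 0) =
          if (i, j) ∈ nu then U.1 i j else if (i, j) ∈ lam then mu.card + 1 else 0) →
        mu ≤ nu := by
      rintro mu nu T U - hle happ ⟨i, j⟩ hc
      by_contra hn
      have h1 := happ i j
      rw [if_pos hc, if_neg hn, if_pos (hle hc)] at h1
      have := (T.2.mapsTo hc).2
      simp only at this
      omega
    have hmn : mu = nu := le_antisymm (key T U hc (hmem.1 hmu).2 happ)
      (key U T hc.symm (hmem.1 hnu).2 fun i j => by rw [← hc]; exact (happ i j).symm)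
    subst hmn
    congr 1
    refine Subtype.ext (SemistandardYoungTableau.ext fun i j => ?_)
    by_cases hij : (i, j) ∈ mu
    · simpa [hij] using happ i j
    · rw [T.1.zeros hij, U.1.zeros hij]
  · rintro ⟨S, hS⟩
    have hm : m ≤ lam.card := by omega
    have hle := sublevelDiagram_le S m
    have hsc := card_sublevelDiagram hS hm
    have hstd : IsStandard (restrictTableau hle S) := by
      unfold IsStandard
      rw [hsc]
      exact (bijOn_sublevelDiagram hS hm).congr fun d hd => (if_pos hd).symm
    refine ⟨⟨⟨sublevelDiagram S m, hmem.2 ⟨hsc, hle⟩⟩, ⟨_, hstd⟩⟩, ?_⟩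
    refine Subtype.ext (SemistandardYoungTableau.ext fun i j => ?_)
    simp only [extendTableau_apply, hsc]
    change (if _ then (if _ then _ else _) else _) = _
    split_ifs with h1 h2
    · rfl
    · have h3 := (hS.mapsTo h2).2
      have h4 : ¬ S i j ≤ m := fun h => h1 (mem_sublevelDiagram.2 ⟨h2, h⟩)
      exact le_antisymm (Nat.lt_of_not_le h4) (hlam ▸ h3)
    · exact (S.zeros h2).symm

theorem card_bot : (⊥ : YoungDiagram).card = 0 := rfl

theorem numSYT_bot : numSYT ⊥ = 1 := by
  have hz : ∀ (T : SemistandardYoungTableau ⊥) (i j : ℕ), T i j = 0 := fun T i j =>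
    T.zeros (YoungDiagram.notMem_bot _)
  refine Nat.card_eq_one_iff_exists.2 ⟨⟨default, ?_⟩, ?_⟩
  · unfold IsStandard
    rw [card_bot]
    simp
  · rintro ⟨T, hT⟩
    exact Subtype.ext (SemistandardYoungTableau.ext fun i j => by rw [hz, hz])

theorem partitionsOf_zero : partitionsOf 0 = {⊥} := by
  ext mu
  rw [mem_partitionsOf, Finset.mem_singleton]
  constructor
  · intro h
    exact YoungDiagram.ext (Finset.card_eq_zero.1 h)
  · rintro rfl
    rfl

/-! ### The Pieri rule for one cell -/

theorem colLen_injective {mu nu : YoungDiagram} (h : ∀ j, mu.colLen j = nu.colLen j) :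
    mu = nu := by
  refine SetLike.ext fun ⟨i, j⟩ => ?_
  rw [YoungDiagram.mem_iff_lt_colLen, YoungDiagram.mem_iff_lt_colLen, h]

/-- The added cell sits at the foot of its column. The bound on `q` allows for at most one new
column. -/
theorem exists_colLen_eq_update {mu lam : YoungDiagram} (hle : mu ≤ lam)
    (hcard : lam.card = mu.card + 1) :
    ∃ q ≤ mu.rowLen 0, ∀ j, lam.colLen j = Function.update mu.colLen q (mu.colLen q + 1) j := by
  obtain ⟨⟨p, q⟩, hc, hins⟩ := exists_cells_eq_insert hle hcard
  have hmem : ∀ i j, (i, j) ∈ lam ↔ (i = p ∧ j = q) ∨ i < mu.colLen j := by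
    intro i j
    rw [← YoungDiagram.mem_cells, hins, Finset.mem_insert, Prod.mk.injEq, YoungDiagram.mem_cells,
      YoungDiagram.mem_iff_lt_colLen]
  rw [YoungDiagram.mem_cells, YoungDiagram.mem_iff_lt_colLen] at hc
  have hpq : (p, q) ∈ lam := (hmem p q).2 (Or.inl ⟨rfl, rfl⟩)
  have hp : p = mu.colLen q := by
    have := (hmem (mu.colLen q) q).1 (lam.up_left_mem (not_lt.1 hc) le_rfl hpq)
    omega
  refine ⟨q, ?_, fun j => ?_⟩
  · by_contra hq
    have h1 := (hmem p (q - 1)).1 (lam.up_left_mem le_rfl (Nat.sub_le q 1) hpq)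
    have h2 : (0, q - 1) ∈ mu := YoungDiagram.mem_iff_lt_colLen.2 (by omega)
    rw [YoungDiagram.mem_iff_lt_rowLen] at h2
    omega
  · refine colLen_eq_of_mem fun i => ?_
    rw [hmem]
    by_cases hj : j = q
    · subst hj
      rw [Function.update_self]
      omega
    · rw [Function.update_of_ne hj]
      simp [hj]

theorem exists_add_cell {mu : YoungDiagram} {q : ℕ}
    (hq : q = 0 ∨ mu.colLen q < mu.colLen (q - 1)) :
    ∃ lam : YoungDiagram, mu ≤ lam ∧ lam.card = mu.card + 1 ∧
      mu.colLen q < lam.colLen q := by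
  refine ⟨⟨insert (mu.colLen q, q) mu.cells, ?_⟩, ?_, ?_, ?_⟩
  · rintro ⟨a, b⟩ ⟨c, d⟩ ⟨h1, h2⟩ h
    simp only [Finset.coe_insert, Set.mem_insert_iff, Finset.mem_coe, YoungDiagram.mem_cells,
      Prod.mk.injEq] at h ⊢
    simp only at h1 h2
    rcases h with ⟨rfl, rfl⟩ | h
    · rw [YoungDiagram.mem_iff_lt_colLen]
      rcases h2.eq_or_lt with rfl | h3
      · omega
      · have := mu.colLen_anti d (b - 1) (by omega)
        omega
    · exact Or.inr (mu.up_left_mem h1 h2 h)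
  · rw [← YoungDiagram.cells_subset_iff]
    exact Finset.subset_insert _ _
  · refine Finset.card_insert_of_notMem ?_
    rw [YoungDiagram.mem_cells, YoungDiagram.mem_iff_lt_colLen]
    exact lt_irrefl _
  · rw [← YoungDiagram.mem_iff_lt_colLen, ← YoungDiagram.mem_cells]
    exact Finset.mem_insert_self _ _

open Classical in
theorem coeff_elemSymm (d : ℤ) (a : ℕ →₀ ℕ) : MvPowerSeries.coeff a (elemSymm d) =
    if (∀ j, a j ≤ 1) ∧ (a.degree : ℤ) = d then 1 else 0 := rfl

theorem elemSymm_zero : elemSymm 0 = 1 := by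
  ext a
  classical
  rw [MvPowerSeries.coeff_one, coeff_elemSymm]
  refine if_congr ?_ rfl rfl
  constructor
  · rintro ⟨-, h⟩
    exact (Finsupp.degree_eq_zero_iff a).1 (by exact_mod_cast h)
  · rintro rfl
    simp

theorem elemSymm_of_neg {d : ℤ} (hd : d < 0) : elemSymm d = 0 := by
  ext a
  rw [coeff_elemSymm, if_neg]
  · rfl
  · rintro ⟨-, h⟩
    omega

/-- The freedom in `n` lets all the Schur functions in the Pieri rule be determinants of one size.
-/
theorem schur_eq_jtDet {mu : YoungDiagram} {n : ℕ} (hn : mu.rowLen 0 ≤ n) :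
    schur mu = jtDet elemSymm n (fun i => mu.colLen i) 0 := by
  induction n, hn using Nat.le_induction with
  | base =>
    have h : schur mu = jtDet elemSymm (mu.transpose.colLen 0)
        (fun i => mu.transpose.rowLen i) 0 := by
      unfold schur jtDet jacobiTrudi
      simp only [bot_rowLen]
      rfl
    rw [h, YoungDiagram.colLen_transpose]
    simp only [YoungDiagram.rowLen_transpose]
  | succ n hn ih =>
    rw [ih, jtDet_succ_of_eq_zero elemSymm_zero fun d => elemSymm_of_neg]
    by_contra h
    have h1 : (0, n) ∈ mu := YoungDiagram.mem_iff_lt_colLen.2 (by omega)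
    rw [YoungDiagram.mem_iff_lt_rowLen] at h1
    omega

open Classical in
theorem elemSymm_one_mul_schur {m : ℕ} {mu : YoungDiagram} (hmu : mu.card = m) :
    elemSymm 1 * schur mu = ∑ lam ∈ (partitionsOf (m + 1)).filter (mu ≤ ·), schur lam := by
  set n := mu.rowLen 0 with hn
  have h0 : ((mu.colLen n : ℕ) : ℤ) = 0 := by
    by_contra h
    have h1 : (0, n) ∈ mu := YoungDiagram.mem_iff_lt_colLen.2 (by omega)
    rw [YoungDiagram.mem_iff_lt_rowLen] at h1
    omega
  have hmem : ∀ {lam}, lam ∈ (partitionsOf (m + 1)).filter (mu ≤ ·) ↔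
      lam.card = mu.card + 1 ∧ mu ≤ lam := by
    intro lam
    rw [Finset.mem_filter, mem_partitionsOf, hmu]
  have hex : ∀ lam ∈ (partitionsOf (m + 1)).filter (mu ≤ ·), ∃ q ≤ n,
      ∀ j, lam.colLen j = Function.update mu.colLen q (mu.colLen q + 1) j := fun lam h =>
    exists_colLen_eq_update (hmem.1 h).2 (hmem.1 h).1
  -- `e lam` is the column that receives the added cell; it determines `lam`.
  choose! e he1 he2 using hex
  rw [schur_eq_jtDet le_rfl, 
    mul_jtDet_eq_sum (a := fun i => (mu.colLen i : ℤ)) (fun d => elemSymm_of_neg) h0,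
    Fin.sum_univ_eq_sum_range (fun i => jtDet elemSymm (n + 1)
      (Function.update (fun i => (mu.colLen i : ℤ)) i ((mu.colLen i : ℤ) + 1)) 0)]
  symm
  refine Finset.sum_of_injOn e ?_ ?_ ?_ ?_
  · intro lam h lam' h' heq
    refine colLen_injective fun j => ?_
    rw [he2 lam h, he2 lam' h', heq]
  · intro lam h
    simpa [Nat.lt_succ_iff] using he1 lam h
  -- If no cell can be added to column `q`, it is as long as column `q - 1`, so incrementing it
  -- gives two equal rows.
  · intro q hq hnot
    have hadd : ¬ (q = 0 ∨ mu.colLen q < mu.colLen (q - 1)) := by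
      intro hadd
      obtain ⟨lam, h1, h2, h3⟩ := exists_add_cell hadd
      have h4 := hmem.2 ⟨h2, h1⟩
      refine hnot ⟨lam, h4, ?_⟩
      by_contra hne
      have := he2 lam h4 q
      rw [Function.update_of_ne (Ne.symm hne)] at this
      omega
    push Not at hadd
    obtain ⟨i, rfl⟩ : ∃ i, q = i + 1 := Nat.exists_eq_succ_of_ne_zero hadd.1
    have h1 := mu.colLen_anti i (i + 1) (Nat.le_succ i)
    refine jtDet_eq_zero elemSymm (Finset.mem_range.1 hq) ?_
    rw [Function.update_self, Function.update_of_ne (Nat.succ_ne_self i).symm]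
    have h2 := hadd.2
    rw [Nat.add_sub_cancel] at h2
    omega
  · intro lam h
    have hlam : lam.rowLen 0 ≤ n + 1 := by
      by_contra hlt
      have h1 : (0, n + 1) ∈ lam := YoungDiagram.mem_iff_lt_rowLen.2 (by omega)
      have h3 := he1 lam h
      rw [YoungDiagram.mem_iff_lt_colLen, he2 lam h, Function.update_of_ne (by omega),
        ← YoungDiagram.mem_iff_lt_colLen, YoungDiagram.mem_iff_lt_rowLen] at h1
      omega
    rw [schur_eq_jtDet hlam]
    refine jtDet_congr _ (fun i _ => ?_) fun _ _ => rfl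
    rw [he2 lam h]
    by_cases hi : i = e lam
    · subst hi
      simp
    · rw [Function.update_of_ne hi, Function.update_of_ne hi]

theorem sum_numSYT_smul_schur (m : ℕ) :
    ∑ mu ∈ partitionsOf m, (numSYT mu : ℚ) • schur mu = elemSymm 1 ^ m := by
  classical
  induction m with
  | zero =>
    rw [partitionsOf_zero, Finset.sum_singleton, numSYT_bot, Nat.cast_one, one_smul, pow_zero,
      schur_eq_jtDet (bot_rowLen 0).le]
    exact Matrix.det_fin_zero
  | succ m ih =>
    have h1 : ∀ lam ∈ partitionsOf (m + 1), (numSYT lam : ℚ) • schur lam =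
        ∑ mu ∈ partitionsOf m, if mu ≤ lam then (numSYT mu : ℚ) • schur lam else 0 := by
      intro lam h
      rw [numSYT_eq_sum (mem_partitionsOf.1 h), Nat.cast_sum, Finset.sum_smul, Finset.sum_filter]
    rw [Finset.sum_congr rfl h1, Finset.sum_comm, pow_succ', ← ih, Finset.mul_sum]
    refine Finset.sum_congr rfl fun mu h => ?_
    rw [mul_smul_comm, elemSymm_one_mul_schur (mem_partitionsOf.1 h), Finset.smul_sum,
      Finset.sum_filter]

/-! ### Coefficients of squarefree monomials -/

theorem coeff_elemSymm_one_single (j : ℕ) :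
    MvPowerSeries.coeff (Finsupp.single j 1) (elemSymm 1) = 1 := by
  rw [coeff_elemSymm, if_pos]
  refine ⟨fun i => ?_, by simp⟩
  rw [Finsupp.single_apply]
  split_ifs <;> simp

theorem exists_of_coeff_elemSymm_one_ne_zero {a : ℕ →₀ ℕ}
    (h : MvPowerSeries.coeff a (elemSymm 1) ≠ 0) : ∃ j, a = Finsupp.single j 1 := by
  have h1 : (∀ j, a j ≤ 1) ∧ (a.degree : ℤ) = 1 := by
    by_contra hn
    exact h (by rw [coeff_elemSymm, if_neg hn])
  have h2 : a.degree = 1 := by exact_mod_cast h1.2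
  have h3 : a ≠ 0 := by
    rintro rfl
    simp at h2
  obtain ⟨j, hj⟩ := Finsupp.ne_iff.1 h3
  have h4 : a = a - Finsupp.single j 1 + Finsupp.single j 1 :=
    (tsub_add_cancel_of_le (Finsupp.single_le_iff.2 (Nat.one_le_iff_ne_zero.2 hj))).symm
  rw [h4, map_add, Finsupp.degree_single, Nat.add_eq_right, Finsupp.degree_eq_zero_iff] at h2
  rw [h2, zero_add] at h4
  exact ⟨j, h4⟩

theorem coeff_inAlphabet_single {k : ℕ} (i : Fin k) (j : ℕ) :
    MvPowerSeries.coeff (Finsupp.single (i, j) 1) (inAlphabet i (elemSymm 1)) = 1 := by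
  have := MvPowerSeries.coeff_embDomain_rename (⟨_, Prod.mk_right_injective i⟩ : ℕ ↪ Fin k × ℕ)
    (elemSymm 1) (Finsupp.single j 1)
  rw [Finsupp.embDomain_single, coeff_elemSymm_one_single] at this
  exact this

theorem exists_of_coeff_inAlphabet_ne_zero {k : ℕ} {i : Fin k} {a : Fin k × ℕ →₀ ℕ}
    (h : MvPowerSeries.coeff a (inAlphabet i (elemSymm 1)) ≠ 0) :
    ∃ j, a = Finsupp.single (i, j) 1 := by
  by_cases ha : a ∈ Set.range (Finsupp.mapDomain fun j : ℕ => (i, j))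
  · obtain ⟨b, rfl⟩ := ha
    have h1 := MvPowerSeries.coeff_embDomain_rename
      (⟨_, Prod.mk_right_injective i⟩ : ℕ ↪ Fin k × ℕ) (elemSymm 1) b
    rw [Finsupp.embDomain_eq_mapDomain] at h1
    obtain ⟨j, rfl⟩ := exists_of_coeff_elemSymm_one_ne_zero (a := b) (by rw [← h1]; exact h)
    exact ⟨j, Finsupp.mapDomain_single⟩
  · exact absurd (MvPowerSeries.coeff_rename_eq_zero _ _ ha) h

/-- Since `e_1` is the sum of the variables, multiplying by it lowers the exponent at each variable
of the alphabet that occurs in the monomial. -/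
theorem coeff_inAlphabet_mul {k : ℕ} (i : Fin k) (F : MvPowerSeries (Fin k × ℕ) ℚ)
    (n : Fin k × ℕ →₀ ℕ) (S : Finset ℕ) (hS : ∀ j, j ∈ S ↔ n (i, j) ≠ 0) :
    MvPowerSeries.coeff n (inAlphabet i (elemSymm 1) * F) =
      ∑ j ∈ S, MvPowerSeries.coeff (n - Finsupp.single (i, j) 1) F := by
  classical
  rw [MvPowerSeries.coeff_mul]
  symm
  have hle : ∀ j ∈ S, Finsupp.single (i, j) 1 ≤ n := fun j hj => by
    rw [Finsupp.single_le_iff]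
    exact Nat.one_le_iff_ne_zero.2 ((hS j).1 hj)
  refine Finset.sum_of_injOn
    (fun j => (Finsupp.single (i, j) 1, n - Finsupp.single (i, j) 1)) ?_ ?_ ?_ ?_
  · intro j _ j' _ h
    have := Finsupp.single_left_injective one_ne_zero (congrArg Prod.fst h)
    exact (Prod.mk.injEq _ _ _ _ ▸ this).2
  · intro j hj
    rw [Finset.mem_coe, Finset.HasAntidiagonal.mem_antidiagonal]
    exact add_tsub_cancel_of_le (hle j hj)
  · rintro ⟨a, b⟩ hab hnot
    rw [Finset.HasAntidiagonal.mem_antidiagonal] at hab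
    refine mul_eq_zero_of_left ?_ _
    by_contra h
    obtain ⟨j, hj⟩ := exists_of_coeff_inAlphabet_ne_zero h
    simp only at hj hab
    subst hj
    refine hnot ⟨j, ?_, ?_⟩
    · rw [Finset.mem_coe, hS, ← hab]
      simp
    · simp only [Prod.mk.injEq, true_and]
      rw [← hab, add_tsub_cancel_left]
  · intro j _
    simp only [coeff_inAlphabet_single, one_mul]

theorem sum_single_apply {k : ℕ} (i i' : Fin k) (S : Finset ℕ) (j : ℕ) :
    (∑ l ∈ S, Finsupp.single (i, l) 1 : Fin k × ℕ →₀ ℕ) (i', j) =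
      if i = i' ∧ j ∈ S then 1 else 0 := by
  classical
  rw [Finsupp.finsetSum_apply]
  simp only [Finsupp.single_apply, Prod.mk.injEq]
  by_cases h : i = i' <;> simp [h]

/-- Each factor `e_1` picks one of the remaining variables, which gives the factorial. A general `S`
is needed because the remaining indices need not form an initial segment; `F` carries the other
alphabets. -/
theorem coeff_inAlphabet_pow_mul {k : ℕ} (i : Fin k) (F : MvPowerSeries (Fin k × ℕ) ℚ)
    {n : Fin k × ℕ →₀ ℕ} (hn : ∀ j, n (i, j) = 0) (S : Finset ℕ) :
    MvPowerSeries.coeff (∑ j ∈ S, Finsupp.single (i, j) 1 + n)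
      (inAlphabet i (elemSymm 1) ^ S.card * F) =
      (S.card.factorial : ℚ) * MvPowerSeries.coeff n F := by
  classical
  induction hc : S.card generalizing S with
  | zero =>
    rw [Finset.card_eq_zero.1 hc]
    simp
  | succ c ih =>
    rw [pow_succ', mul_assoc, coeff_inAlphabet_mul i _ _ S]
    · have h1 : ∀ j ∈ S, MvPowerSeries.coeff
          (∑ j ∈ S, Finsupp.single (i, j) 1 + n - Finsupp.single (i, j) 1)
          (inAlphabet i (elemSymm 1) ^ c * F) =
          (c.factorial : ℚ) * MvPowerSeries.coeff n F := by
        intro j hj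
        rw [← Finset.add_sum_erase S _ hj, add_assoc, add_tsub_cancel_left]
        exact ih _ (by rw [Finset.card_erase_of_mem hj, hc]; rfl)
      rw [Finset.sum_congr rfl h1, Finset.sum_const, hc, nsmul_eq_mul, Nat.factorial_succ]
      push_cast
      ring
    · intro j
      rw [Finsupp.add_apply, hn, sum_single_apply]
      simp

theorem coeff_prod_inAlphabet_pow {k : ℕ} (m : ℕ) (t : Finset (Fin k)) :
    MvPowerSeries.coeff (∑ i ∈ t, ∑ j ∈ Finset.range m, Finsupp.single (i, j) 1)
      (∏ i ∈ t, inAlphabet i (elemSymm 1) ^ m) = (m.factorial : ℚ) ^ t.card := by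
  classical
  induction t using Finset.induction_on with
  | empty => simp
  | insert i t hi ih =>
    rw [Finset.sum_insert hi, Finset.prod_insert hi, Finset.card_insert_of_notMem hi, pow_succ',
      ← ih]
    have h := coeff_inAlphabet_pow_mul i (∏ i ∈ t, inAlphabet i (elemSymm 1) ^ m)
      (n := ∑ i ∈ t, ∑ j ∈ Finset.range m, Finsupp.single (i, j) 1) (fun j => by
        rw [Finsupp.finsetSum_apply]
        refine Finset.sum_eq_zero fun i' hi' => ?_
        rw [sum_single_apply, if_neg]
        rintro ⟨rfl, -⟩
        exact hi hi') (Finset.range m)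
    rwa [Finset.card_range] at h

/-! ### Hadamard products over several alphabets -/

/-- The index of an entry is the same in all alphabets, so the product can be taken inside the
sequence. -/
theorem det_hadamardPower_jacobiTrudi (k : ℕ) (R : SkewShape) :
    (hadamardPower k (jacobiTrudi R)).det =
      skewDet (fun d => ∏ i : Fin k, inAlphabet i (elemSymm d)) R := rfl

theorem sum_det_hadamardPower {k : ℕ} (hk : 1 ≤ k) (m : ℕ) :
    ∑ R ∈ ribbons m, (hadamardPower k (jacobiTrudi R)).det =
      ∏ i : Fin k, inAlphabet i (elemSymm 1) ^ m := by
  simp only [det_hadamardPower_jacobiTrudi]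
  rw [sum_skewDet_ribbons, Finset.prod_pow]
  · intro d hd
    -- This needs a factor to vanish: for `k = 0` the empty product would be `1` at negative `d`.
    exact Finset.prod_eq_zero (Finset.mem_univ ⟨0, hk⟩) (by rw [elemSymm_of_neg hd, map_zero])
  · exact Finset.prod_eq_one fun i _ => by rw [elemSymm_zero, map_one]

theorem prod_sum_numSYT_smul_schur (k m : ℕ) :
    ∏ i : Fin k, ∑ mu ∈ partitionsOf m, (numSYT mu : ℚ) • inAlphabet i (schur mu) =
      ∏ i : Fin k, inAlphabet i (elemSymm 1) ^ m := by
  refine Finset.prod_congr rfl fun i _ => ?_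
  rw [← map_pow, ← sum_numSYT_smul_schur, map_sum]
  simp only [map_smul]

theorem coeff_allOnes_prod (k m : ℕ) :
    MvPowerSeries.coeff (allOnes k m) (∏ i : Fin k, inAlphabet i (elemSymm 1) ^ m) =
      (m.factorial : ℚ) ^ k := by
  have h := coeff_prod_inAlphabet_pow (k := k) m Finset.univ
  rwa [Finset.card_univ, Fintype.card_fin] at h

end HadamardJT

end

open HadamardJT
theorem mainTheorem10 (k m : ℕ) (hk : 1 ≤ k) :
    (∑ R ∈ ribbons m, (hadamardPower k (jacobiTrudi R)).det
      = ∏ i : Fin k, ∑ mu ∈ partitionsOf m, (numSYT mu : ℚ) • inAlphabet i (schur mu)) ∧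
    MvPowerSeries.coeff (allOnes k m)
      (∑ R ∈ ribbons m, (hadamardPower k (jacobiTrudi R)).det) = ((m.factorial : ℚ)) ^ k ∧
    MvPowerSeries.coeff (allOnes k m)
      (∏ i : Fin k, ∑ mu ∈ partitionsOf m, (numSYT mu : ℚ) • inAlphabet i (schur mu))
      = ((m.factorial : ℚ)) ^ k := by
  rw [sum_det_hadamardPower hk, prod_sum_numSYT_smul_schur]
  exact ⟨rfl, coeff_allOnes_prod k m, coeff_allOnes_prod k m⟩
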